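/- Fix $N$, matrices $A, C \in \mathbb{R}^{N\times N}$ with $\operatorname{rank} A = \operatorname{rank} C = N$, and $\sigma_v>0$. For each $M\in\mathbb{N}$ let $G_M\in\mathbb{R}^{M\times N}$ and $R_M=\sigma_v^2 I_M$, and consider the Gaussian dynamic factor model $$x_{t+1}=Ax_t+Cw_{t+1},\qquad y_t=G_Mx_t+v_t,\qquad w_t\sim\mathcal N(0,I_N),\quad v_t\sim\mathcal N(0,R_M),$$ with serially and mutually independent shocks $w$ and measurement errors $v$. Let $\|\cdot\|$ be the Frobenius norm. Assume that $\operatorname{rank} G_M=N$ for all large $M$ and that $G_M^\top G_M$ is of exact order $M$: $\|G_M^\top G_M\|=O(M)$ and $\|(G_M^\top G_M)^{-1}\|=O(1/M)$ as $M\to\infty$. For a positive semidefinite $\Sigma\in\mathbb{R}^{N\times N}$ put $$K_M(\Sigma)=A\Sigma G_M^\top\,(G_M\Sigma G_M^\top+R_M)^{-1}.$$ (i) For every $M$ with $\operatorname{rank} G_M=N$ there is exactly one positive semidefinite $\Sigma=\Sigma_{\infty,M}$ (the steady-state prediction covariance) that solves, with $K=K_M(\Sigma)$, the Riccati equation $$\Sigma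 = CC^\top + K R_M K^\top + (A-KG_M)\,\Sigma\,(A-KG_M)^\top,$$ and it is invertible. (ii) With $K_M=K_M(\Sigma_{\infty,M})$, as $M\to\infty$, $$\Sigma_{\infty,M}\to CC^\top,\qquad A-K_MG_M\to 0,\qquad \limsup_{M\to\infty} M\,\|A-K_MG_M\|<\infty .$$ (iii) The three claims of (ii) hold as well if $\Sigma_{\infty,M}$ is replaced, for any fixed $t$, by the prediction covariance $\mathbb{E}\big[(x_t-\mathbb{E}[x_t\mid y_s,\,s<t])(x_t-\mathbb{E}[x_t\mid y_s,\,s<t])^\top\big]$ of a stationary Gaussian realization $(x_t,y_t)_{t\in\mathbb{Z}}$ of the $M$-th model, in which $x$ is independent of $v$ and, for each $t$, the shocks $(w_s)_{s>t}$ are independent of $(x_s)_{s\le t}$ and $v$ jointly. -/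

import Mathlib

open Filter Topology MeasureTheory ProbabilityTheory Asymptotics
open scoped Matrix Matrix.Norms.Frobenius

noncomputable section

/-- The filter gain `K = A Σ Gᵀ Ω⁻¹` with `Ω = G Σ Gᵀ + R`. -/
def kalmanGain {N M : ℕ} (A : Matrix (Fin N) (Fin N) ℝ) (G : Matrix (Fin M) (Fin N) ℝ)
    (R : Matrix (Fin M) (Fin M) ℝ) (S : Matrix (Fin N) (Fin N) ℝ) :
    Matrix (Fin N) (Fin M) ℝ :=
  A * S * Gᵀ * (G * S * Gᵀ + R)⁻¹

/-- The filter matrix `A - K G` belonging to the prediction covariance `S`. -/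
def filterMatrix {N M : ℕ} (A : Matrix (Fin N) (Fin N) ℝ) (G : Matrix (Fin M) (Fin N) ℝ)
    (R : Matrix (Fin M) (Fin M) ℝ) (S : Matrix (Fin N) (Fin N) ℝ) :
    Matrix (Fin N) (Fin N) ℝ :=
  A - kalmanGain A G R S * G

/-- `S` is a steady-state prediction covariance: a positive semidefinite solution of
`S = C Cᵀ + K R Kᵀ + (A - K G) S (A - K G)ᵀ`, where `K` is the gain belonging to `S`. -/
structure IsSteadyStateCov {N M : ℕ} (A C : Matrix (Fin N) (Fin N) ℝ)
    (G : Matrix (Fin M) (Fin N) ℝ) (R : Matrix (Fin M) (Fin M) ℝ)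
    (S : Matrix (Fin N) (Fin N) ℝ) : Prop where
  posSemidef : S.PosSemidef
  riccati : S = C * Cᵀ + kalmanGain A G R S * R * (kalmanGain A G R S)ᵀ
    + filterMatrix A G R S * S * (filterMatrix A G R S)ᵀ

/-- The restrictions on a sequence of dynamic factor models indexed by the number `M` of
observables. All norms are Frobenius norms; `Gᵀ G` is of exact order `M`. -/
structure FactorModelAssumption {N : ℕ} (A : Matrix (Fin N) (Fin N) ℝ)
    (G : ∀ M : ℕ, Matrix (Fin M) (Fin N) ℝ) (R : ∀ M : ℕ, Matrix (Fin M) (Fin M) ℝ)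
    (σ : ℝ) : Prop where
  rank_A : A.rank = N
  rank_G : ∀ᶠ M in atTop, (G M).rank = N
  gram_isBigO : (fun M : ℕ => ‖(G M)ᵀ * G M‖) =O[atTop] fun M : ℕ => (M : ℝ)
  gram_inv_isBigO : (fun M : ℕ => ‖((G M)ᵀ * G M)⁻¹‖) =O[atTop] fun M : ℕ => (M : ℝ)⁻¹
  sigma_pos : 0 < σ
  noise : ∀ M, R M = σ ^ 2 • (1 : Matrix (Fin M) (Fin M) ℝ)

/-- A stationary Gaussian realization, with time running over `ℤ`, of
`x (t+1) = A x t + C w (t+1)`, `y t = G x t + v t`, where `w t ∼ N(0, I)` and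
`v t ∼ N(0, σ² I)` are serially and mutually independent, and where the shocks after time `t`
are independent of the states up to time `t`. -/
structure IsStationaryDFM {N M : ℕ} {Ω : Type*} [MeasurableSpace Ω] (μ : Measure Ω)
    (A C : Matrix (Fin N) (Fin N) ℝ) (G : Matrix (Fin M) (Fin N) ℝ) (σ : ℝ)
    (x w : ℤ → Ω → Fin N → ℝ) (y v : ℤ → Ω → Fin M → ℝ) : Prop where
  measurable_x : ∀ t, Measurable (x t)
  measurable_w : ∀ t, Measurable (w t)
  measurable_y : ∀ t, Measurable (y t)
  measurable_v : ∀ t, Measurable (v t)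
  transition : ∀ t, ∀ᵐ ω ∂μ, x (t + 1) ω = A *ᵥ x t ω + C *ᵥ w (t + 1) ω
  measurement : ∀ t, ∀ᵐ ω ∂μ, y t ω = G *ᵥ x t ω + v t ω
  law_w : ∀ t, μ.map (w t) = Measure.pi fun _ => gaussianReal 0 1
  law_v : ∀ t, μ.map (v t) = Measure.pi fun _ => gaussianReal 0 (σ ^ 2).toNNReal
  iIndep_w : iIndepFun w μ
  iIndep_v : iIndepFun v μ
  indep_w_v : IndepFun (fun ω t => w t ω) (fun ω t => v t ω) μ
  indep_x_v : IndepFun (fun ω t => x t ω) (fun ω t => v t ω) μ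
  causal : ∀ t : ℤ, IndepFun
    (fun ω => ((fun s : Set.Iic t => x s ω), (fun s : ℤ => v s ω)))
    (fun ω => fun s : Set.Ioi t => w s ω) μ
  gaussian_x : ∀ t, IsGaussian (μ.map (x t))
  stationary_x : ∀ s t, μ.map (x s) = μ.map (x t)

/-- The information in the observables strictly before time `t`. -/
def pastObs {M : ℕ} {Ω : Type*} (y : ℤ → Ω → Fin M → ℝ) (t : ℤ) : MeasurableSpace Ω :=
  ⨆ s : Set.Iio t, MeasurableSpace.comap (y s) inferInstance

/-- The prediction error `x t - E[x t | y s, s < t]`, coordinate by coordinate. -/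
def predictionError {N M : ℕ} {Ω : Type*} [MeasurableSpace Ω] (μ : Measure Ω)
    (x : ℤ → Ω → Fin N → ℝ) (y : ℤ → Ω → Fin M → ℝ) (t : ℤ) (ω : Ω) (i : Fin N) : ℝ :=
  x t ω i - (μ[fun ω' => x t ω' i | pastObs y t]) ω

/-- The covariance matrix of the prediction error at time `t`. -/
def predictionCov {N M : ℕ} {Ω : Type*} [MeasurableSpace Ω] (μ : Measure Ω)
    (x : ℤ → Ω → Fin N → ℝ) (y : ℤ → Ω → Fin M → ℝ) (t : ℤ) : Matrix (Fin N) (Fin N) ℝ :=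
  Matrix.of fun i j =>
    ∫ ω, predictionError μ x y t ω i * predictionError μ x y t ω j ∂μ

/-- The three asymptotic claims for covariances `S M`: `S M → C Cᵀ`, `A - K G → 0` and
`limsup M ‖A - K G‖ < ∞`. -/
structure FilterCollapses {N : ℕ} (A C : Matrix (Fin N) (Fin N) ℝ)
    (G : ∀ M : ℕ, Matrix (Fin M) (Fin N) ℝ) (R : ∀ M : ℕ, Matrix (Fin M) (Fin M) ℝ)
    (S : ℕ → Matrix (Fin N) (Fin N) ℝ) : Prop where
  cov_tendsto : Tendsto S atTop (𝓝 (C * Cᵀ))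
  filter_tendsto : Tendsto (fun M => filterMatrix A (G M) (R M) (S M)) atTop (𝓝 0)
  rate : limsup (fun M : ℕ =>
    (((M : ℝ) * ‖filterMatrix A (G M) (R M) (S M)‖ : ℝ) : EReal)) atTop < ⊤

end

/-!
Let `Γ = Gᵀ R⁻¹ G` be the information matrix of the observation. In the Loewner order every steady
state `S` satisfies `C Cᵀ ≤ S ≤ C Cᵀ + A Γ⁻¹ Aᵀ`. The lower bound drops the other two summands of
the Riccati equation. For the upper bound, the Kalman gain minimizes the right-hand side of the
equation over all gains, and the generalized least squares gain `L = A Γ⁻¹ Gᵀ R⁻¹` has `L G = A`,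
which leaves only `C Cᵀ + L R Lᵀ`. As `Γ⁻¹ = O(1/M)`, this squeezes `S` to `C Cᵀ`, and the filter
matrix `A - K G = A Γ⁻¹ (Γ⁻¹ + S)⁻¹` is `O(1/M)`.

Existence: the iterates of the (monotone) Riccati map from `0` increase and are bounded through the
gain `L`. Uniqueness: for steady states `S` and `T`, minimality of the Kalman gain gives
`S - T ≤ F (S - T) Fᵀ` with `F` the filter matrix at `T`, while `F T Fᵀ ≤ q T` for some `q < 1`
because `C Cᵀ` is positive definite. Iterating, `S ≤ T`.

The prediction covariance of a realization obeys the same two bounds. It equals `C Cᵀ + A P Aᵀ`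
with `P` the covariance of the error in estimating `x t` from `y s`, `s ≤ t`, and `P ≤ Γ⁻¹` because
the conditional expectation is at least as good as the least squares estimate from `y t` alone.
-/

section LoewnerOrder

open scoped MatrixOrder ComplexOrder

variable {m n 𝕜 : Type*} [RCLike 𝕜]

lemma frobenius_norm_sq_eq_re_trace [Fintype m] [Fintype n] (B : Matrix m n 𝕜) :
    ‖B‖ ^ 2 = RCLike.re (Bᴴ * B).trace := by
  rw [Matrix.frobenius_norm_def, ← Real.sqrt_eq_rpow, Real.sq_sqrt (by positivity),
    Finset.sum_comm]
  simp only [Matrix.trace, Matrix.diag_apply, Matrix.mul_apply, Matrix.conjTranspose_apply,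
    RCLike.star_def, RCLike.conj_mul, map_sum]
  norm_cast

lemma norm_le_re_trace_of_posSemidef [Fintype n] {P : Matrix n n 𝕜} (hP : P.PosSemidef) :
    ‖P‖ ≤ RCLike.re P.trace := by
  classical
  obtain ⟨B, rfl⟩ := CStarAlgebra.nonneg_iff_eq_star_mul_self.1 hP.nonneg
  rw [Matrix.star_eq_conjTranspose, ← frobenius_norm_sq_eq_re_trace, sq]
  exact (Matrix.frobenius_norm_mul _ _).trans_eq (by rw [Matrix.frobenius_norm_conjTranspose])

lemma norm_sub_le_re_trace_sub [Fintype n] {P Q : Matrix n n 𝕜} (h : P ≤ Q) :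
    ‖Q - P‖ ≤ RCLike.re Q.trace - RCLike.re P.trace := by
  simpa using norm_le_re_trace_of_posSemidef (Matrix.le_iff.1 h)

lemma monotone_re_trace [Fintype n] : Monotone fun P : Matrix n n 𝕜 => RCLike.re P.trace :=
  fun _ _ h => sub_nonneg.1 ((norm_nonneg _).trans (norm_sub_le_re_trace_sub h))

/-- The trace dominates the Frobenius norm of the increments, so convergence of the traces makes
the sequence Cauchy. -/
lemma exists_tendsto_of_monotone_of_le [Finite n] {S : ℕ → Matrix n n 𝕜} (hS : Monotone S)
    {B : Matrix n n 𝕜} (hB : ∀ k, S k ≤ B) : ∃ T, Tendsto S atTop (𝓝 T) := by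
  cases nonempty_fintype n
  set τ : ℕ → ℝ := fun k => RCLike.re (S k).trace
  have hbdd : BddAbove (Set.range τ) :=
    ⟨_, Set.forall_mem_range.2 fun k => monotone_re_trace (hB k)⟩
  have hτ : Tendsto τ atTop (𝓝 (⨆ k, τ k)) :=
    tendsto_atTop_ciSup (monotone_re_trace.comp hS) hbdd
  refine cauchySeq_tendsto_of_complete (cauchySeq_of_le_tendsto_0' (fun k => (⨆ j, τ j) - τ k)
    (fun k j hkj => ?_) (by simpa using hτ.const_sub (⨆ j, τ j)))
  rw [dist_comm, dist_eq_norm]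
  exact (norm_sub_le_re_trace_sub (hS hkj)).trans (sub_le_sub_right (le_ciSup hbdd j) _)

instance [Finite n] : OrderClosedTopology (Matrix n n 𝕜) where
  isClosed_le' := by
    cases nonempty_fintype n
    refine isClosed_le_of_isClosed_nonneg ?_
    simp only [Matrix.nonneg_iff_posSemidef, Matrix.posSemidef_iff_dotProduct_mulVec,
      Set.ofPred_and, Set.ofPred_forall]
    refine (isClosed_eq continuous_star continuous_id).inter (isClosed_iInter fun a => ?_)
    exact isClosed_le continuous_const (by fun_prop)

variable {P Q : Matrix n n ℝ}

lemma transpose_eq_of_posSemidef (hP : P.PosSemidef) : Pᵀ = P := by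
  simpa using hP.isHermitian.eq

lemma mul_mul_transpose_mono [Finite m] [Fintype n] (h : P ≤ Q) (B : Matrix m n ℝ) :
    B * P * Bᵀ ≤ B * Q * Bᵀ := by
  rw [Matrix.le_iff] at h ⊢
  simpa [Matrix.mul_sub, Matrix.sub_mul] using h.mul_mul_conjTranspose_same B

lemma posSemidef_mul_mul_transpose [Finite m] [Fintype n] (hP : P.PosSemidef) (B : Matrix m n ℝ) :
    (B * P * Bᵀ).PosSemidef := by
  simpa using hP.mul_mul_conjTranspose_same B

lemma posDef_of_le (hP : P.PosDef) (h : P ≤ Q) : Q.PosDef := by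
  simpa using hP.add_posSemidef (Matrix.le_iff.1 h)

lemma mulVec_injective_of_rank_eq_card [Fintype n] {B : Matrix m n ℝ}
    (hB : B.rank = Fintype.card n) : Function.Injective B.mulVec := by
  rw [Matrix.mulVec_injective_iff, linearIndependent_iff_card_eq_finrank_span, Set.finrank,
    ← Matrix.rank_eq_finrank_span_cols, hB]

lemma posDef_mul_transpose_self_of_isUnit [Fintype n] [DecidableEq n] {B : Matrix n n ℝ}
    (hB : IsUnit B) : (B * Bᵀ).PosDef := by
  simpa using Matrix.PosDef.mul_conjTranspose_self B (Matrix.vecMul_injective_of_isUnit hB)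

lemma exists_le_smul_one [Finite n] [DecidableEq n] (hP : P.IsHermitian) :
    ∃ c : ℝ, 1 ≤ c ∧ P ≤ c • (1 : Matrix n n ℝ) := by
  cases nonempty_fintype n
  obtain ⟨b, hb⟩ := P.finite_real_spectrum.bddAbove
  refine ⟨max 1 b, le_max_left _ _, ?_⟩
  rw [← Algebra.algebraMap_eq_smul_one]
  exact le_algebraMap_of_spectrum_le (fun x hx => (hb hx).trans (le_max_right _ _)) hP

lemma exists_le_smul_of_posDef [Finite n] (hP : P.IsHermitian) (hQ : Q.PosDef) :
    ∃ c : ℝ, 1 ≤ c ∧ P ≤ c • Q := by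
  classical
  cases nonempty_fintype n
  cases isEmpty_or_nonempty n
  · exact ⟨1, le_rfl, (Subsingleton.elim P _).le⟩
  obtain ⟨c, hc, hPc⟩ := exists_le_smul_one hP
  obtain ⟨b, hb, hbQ⟩ := (CFC.exists_pos_algebraMap_le_iff (a := Q) hQ.isHermitian).2 fun x hx =>
    (Matrix.isStrictlyPositive_iff_posDef.2 hQ).spectrum_pos hx
  rw [Algebra.algebraMap_eq_smul_one] at hbQ
  refine ⟨max 1 (c / b), le_max_left _ _, hPc.trans ?_⟩
  calc c • (1 : Matrix n n ℝ) = (c / b) • b • (1 : Matrix n n ℝ) := by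
        rw [smul_smul, div_mul_cancel₀ c hb.ne']
    _ ≤ (c / b) • Q := smul_le_smul_of_nonneg_left hbQ (by positivity)
    _ ≤ max 1 (c / b) • Q := smul_le_smul_of_nonneg_right (le_max_right _ _) hQ.posSemidef.nonneg

end LoewnerOrder

section Riccati

open scoped MatrixOrder

variable {N M : ℕ}

/-- The Joseph form of the covariance update: the covariance of the prediction error after one
step from the covariance `S` if the gain `L`, optimal or not, is used. -/
noncomputable def josephForm (A C : Matrix (Fin N) (Fin N) ℝ) (G : Matrix (Fin M) (Fin N) ℝ)
    (R : Matrix (Fin M) (Fin M) ℝ) (S : Matrix (Fin N) (Fin N) ℝ) (L : Matrix (Fin N) (Fin M) ℝ) :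
    Matrix (Fin N) (Fin N) ℝ :=
  C * Cᵀ + L * R * Lᵀ + (A - L * G) * S * (A - L * G)ᵀ

/-- The Riccati map, whose positive semidefinite fixed points are the steady-state prediction
covariances. -/
noncomputable def riccatiMap (A C : Matrix (Fin N) (Fin N) ℝ) (G : Matrix (Fin M) (Fin N) ℝ)
    (R : Matrix (Fin M) (Fin M) ℝ) (S : Matrix (Fin N) (Fin N) ℝ) : Matrix (Fin N) (Fin N) ℝ :=
  josephForm A C G R S (kalmanGain A G R S)

variable {A C : Matrix (Fin N) (Fin N) ℝ} {G : Matrix (Fin M) (Fin N) ℝ}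
  {R : Matrix (Fin M) (Fin M) ℝ} {S T : Matrix (Fin N) (Fin N) ℝ}

lemma innovationCov_posDef (hR : R.PosDef) (hS : S.PosSemidef) : (G * S * Gᵀ + R).PosDef :=
  hR.posSemidef_add (posSemidef_mul_mul_transpose hS G)

lemma kalmanGain_mul_innovationCov (hR : R.PosDef) (hS : S.PosSemidef) :
    kalmanGain A G R S * (G * S * Gᵀ + R) = A * S * Gᵀ :=
  Matrix.nonsing_inv_mul_cancel_right _ _
    ((Matrix.isUnit_iff_isUnit_det _).1 (innovationCov_posDef hR hS).isUnit)

lemma innovationCov_mul_transpose_kalmanGain (hR : R.PosDef) (hS : S.PosSemidef) :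
    (G * S * Gᵀ + R) * (kalmanGain A G R S)ᵀ = G * S * Aᵀ := by
  have h := congrArg Matrix.transpose (kalmanGain_mul_innovationCov (A := A) (G := G) hR hS)
  rw [Matrix.transpose_mul,
    transpose_eq_of_posSemidef (innovationCov_posDef hR hS).posSemidef] at h
  simpa [transpose_eq_of_posSemidef hS, Matrix.mul_assoc] using h

/-- Completing the square in the gain. -/
lemma josephForm_sub_riccatiMap (hR : R.PosDef) (hS : S.PosSemidef)
    (L : Matrix (Fin N) (Fin M) ℝ) :
    josephForm A C G R S L - riccatiMap A C G R S =
      (L - kalmanGain A G R S) * (G * S * Gᵀ + R) * (L - kalmanGain A G R S)ᵀ := by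
  have hexpand : ∀ L : Matrix (Fin N) (Fin M) ℝ, josephForm A C G R S L =
      C * Cᵀ + A * S * Aᵀ - L * (G * S * Aᵀ) - A * S * Gᵀ * Lᵀ
        + L * (G * S * Gᵀ + R) * Lᵀ := fun L => by
    simp only [josephForm, Matrix.transpose_sub, Matrix.transpose_mul, Matrix.mul_sub,
      Matrix.sub_mul, Matrix.mul_add, Matrix.add_mul, Matrix.mul_assoc]
    abel
  rw [riccatiMap, hexpand, hexpand, ← kalmanGain_mul_innovationCov hR hS,
    ← innovationCov_mul_transpose_kalmanGain hR hS]
  simp only [Matrix.transpose_sub, Matrix.mul_sub, Matrix.sub_mul, Matrix.mul_assoc]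
  abel

lemma riccatiMap_le_josephForm (hR : R.PosDef) (hS : S.PosSemidef)
    (L : Matrix (Fin N) (Fin M) ℝ) : riccatiMap A C G R S ≤ josephForm A C G R S L := by
  rw [Matrix.le_iff, josephForm_sub_riccatiMap hR hS]
  exact posSemidef_mul_mul_transpose (innovationCov_posDef hR hS).posSemidef _

lemma josephForm_mono (L : Matrix (Fin N) (Fin M) ℝ) :
    Monotone fun S => josephForm A C G R S L := fun _ _ h =>
  add_le_add_right (mul_mul_transpose_mono h _) _

lemma riccatiMap_mono (hR : R.PosDef) (hS : S.PosSemidef) (h : S ≤ T) :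
    riccatiMap A C G R S ≤ riccatiMap A C G R T :=
  (riccatiMap_le_josephForm hR hS _).trans (josephForm_mono _ h)

lemma mul_transpose_le_riccatiMap (hR : R.PosDef) (hS : S.PosSemidef) :
    C * Cᵀ ≤ riccatiMap A C G R S := by
  rw [Matrix.le_iff, riccatiMap, josephForm, add_assoc, add_sub_cancel_left]
  exact (posSemidef_mul_mul_transpose hR.posSemidef _).add (posSemidef_mul_mul_transpose hS _)

lemma riccatiMap_posSemidef (hR : R.PosDef) (hS : S.PosSemidef) :
    (riccatiMap A C G R S).PosSemidef := by
  have hCC : (C * Cᵀ).PosSemidef := by simpa using Matrix.posSemidef_self_mul_conjTranspose C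
  exact Matrix.nonneg_iff_posSemidef.1 (hCC.nonneg.trans (mul_transpose_le_riccatiMap hR hS))

lemma riccatiMap_le_of_mul_eq (hR : R.PosDef) (hS : S.PosSemidef) {L : Matrix (Fin N) (Fin M) ℝ}
    (hL : L * G = A) : riccatiMap A C G R S ≤ C * Cᵀ + L * R * Lᵀ := by
  simpa [josephForm, hL] using riccatiMap_le_josephForm (A := A) (C := C) (G := G) hR hS L

lemma continuousAt_nonsing_inv {n : Type*} [Fintype n] [DecidableEq n] {P : Matrix n n ℝ}
    (hP : IsUnit P) : ContinuousAt (fun Q : Matrix n n ℝ => Q⁻¹) P := by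
  simp only [Matrix.nonsing_inv_eq_ringInverse]
  obtain ⟨u, rfl⟩ := hP
  exact NormedRing.inverse_continuousAt u

lemma continuousAt_riccatiMap (hR : R.PosDef) (hS : S.PosSemidef) :
    ContinuousAt (riccatiMap A C G R) S := by
  have hinv : ContinuousAt (fun T => (T, (G * T * Gᵀ + R)⁻¹)) S :=
    continuousAt_id.prodMk <| ContinuousAt.comp (f := fun T => G * T * Gᵀ + R)
      (continuousAt_nonsing_inv (innovationCov_posDef hR hS).isUnit) (by fun_prop)
  have hjoseph : Continuous fun p : Matrix (Fin N) (Fin N) ℝ × Matrix (Fin M) (Fin M) ℝ =>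
      josephForm A C G R p.1 (A * p.1 * Gᵀ * p.2) := by
    unfold josephForm
    fun_prop
  exact ContinuousAt.comp (f := fun T => (T, (G * T * Gᵀ + R)⁻¹)) hjoseph.continuousAt hinv

lemma isSteadyStateCov_iff :
    IsSteadyStateCov A C G R S ↔ S.PosSemidef ∧ riccatiMap A C G R S = S :=
  ⟨fun h => ⟨h.1, h.2.symm⟩, fun h => ⟨h.1, h.2.symm⟩⟩

lemma posSemidef_iterate_riccatiMap (hR : R.PosDef) (k : ℕ) :
    ((riccatiMap A C G R)^[k] 0).PosSemidef := by
  induction k with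
  | zero => exact .zero
  | succ k ih =>
    rw [Function.iterate_succ_apply']
    exact riccatiMap_posSemidef hR ih

lemma monotone_iterate_riccatiMap (hR : R.PosDef) :
    Monotone fun k => (riccatiMap A C G R)^[k] 0 := by
  refine monotone_nat_of_le_succ fun k => ?_
  induction k with
  | zero => exact (posSemidef_iterate_riccatiMap hR 1).nonneg
  | succ k ih =>
    rw [Function.iterate_succ_apply', Function.iterate_succ_apply' _ (k + 1)]
    exact riccatiMap_mono hR (posSemidef_iterate_riccatiMap hR k) ih

lemma exists_isSteadyStateCov (hR : R.PosDef) {L : Matrix (Fin N) (Fin M) ℝ} (hL : L * G = A) :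
    ∃ S, IsSteadyStateCov A C G R S := by
  have hpos := posSemidef_iterate_riccatiMap (A := A) (C := C) (G := G) hR
  have hmono := monotone_iterate_riccatiMap (A := A) (C := C) (G := G) hR
  have hbound : ∀ k, (riccatiMap A C G R)^[k] 0 ≤ C * Cᵀ + L * R * Lᵀ := fun k =>
    (hmono k.le_succ).trans <| by
      simp only [Function.iterate_succ_apply']
      exact riccatiMap_le_of_mul_eq hR (hpos k) hL
  obtain ⟨S, hS⟩ := exists_tendsto_of_monotone_of_le hmono hbound
  have hSpos : S.PosSemidef :=
    Matrix.nonneg_iff_posSemidef.1 (ge_of_tendsto' hS fun k => (hpos k).nonneg)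
  exact ⟨S, isSteadyStateCov_iff.2 ⟨hSpos, isFixedPt_of_tendsto_iterate hS
    (continuousAt_riccatiMap hR hSpos)⟩⟩

lemma IsSteadyStateCov.mul_transpose_le (hS : IsSteadyStateCov A C G R S) (hR : R.PosDef) :
    C * Cᵀ ≤ S :=
  (mul_transpose_le_riccatiMap hR hS.posSemidef).trans_eq (isSteadyStateCov_iff.1 hS).2

lemma IsSteadyStateCov.le_of_mul_eq (hS : IsSteadyStateCov A C G R S) (hR : R.PosDef)
    {L : Matrix (Fin N) (Fin M) ℝ} (hL : L * G = A) : S ≤ C * Cᵀ + L * R * Lᵀ :=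
  (isSteadyStateCov_iff.1 hS).2.symm.trans_le (riccatiMap_le_of_mul_eq hR hS.posSemidef hL)

lemma IsSteadyStateCov.posDef (hS : IsSteadyStateCov A C G R S) (hR : R.PosDef)
    (hC : IsUnit C) : S.PosDef :=
  posDef_of_le (posDef_mul_transpose_self_of_isUnit hC) (hS.mul_transpose_le hR)

lemma IsSteadyStateCov.sub_le (hS : IsSteadyStateCov A C G R S) (hT : IsSteadyStateCov A C G R T)
    (hR : R.PosDef) :
    S - T ≤ filterMatrix A G R T * (S - T) * (filterMatrix A G R T)ᵀ := by
  calc S - T = riccatiMap A C G R S - riccatiMap A C G R T := by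
        rw [(isSteadyStateCov_iff.1 hS).2, (isSteadyStateCov_iff.1 hT).2]
    _ ≤ josephForm A C G R S (kalmanGain A G R T) - riccatiMap A C G R T :=
        sub_le_sub_right (riccatiMap_le_josephForm hR hS.posSemidef _) _
    _ = filterMatrix A G R T * (S - T) * (filterMatrix A G R T)ᵀ := by
        rw [riccatiMap, josephForm, josephForm, add_sub_add_left_eq_sub, filterMatrix,
          ← Matrix.sub_mul, ← Matrix.mul_sub]

/-- Since `C Cᵀ` is positive definite, it takes a fixed fraction away from `T` in every step. -/
lemma IsSteadyStateCov.exists_filterMatrix_mul_mul_le (hT : IsSteadyStateCov A C G R T)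
    (hR : R.PosDef) (hC : IsUnit C) : ∃ q : ℝ, 0 ≤ q ∧ q < 1 ∧
      filterMatrix A G R T * T * (filterMatrix A G R T)ᵀ ≤ q • T := by
  obtain ⟨d, hd, hTd⟩ := exists_le_smul_of_posDef hT.posSemidef.isHermitian
    (posDef_mul_transpose_self_of_isUnit hC)
  have hd0 : 0 < d := one_pos.trans_le hd
  refine ⟨1 - d⁻¹, sub_nonneg.2 (inv_le_one_of_one_le₀ hd), sub_lt_self _ (inv_pos.2 hd0), ?_⟩
  have hdT : d⁻¹ • T ≤ C * Cᵀ := (inv_smul_le_iff_of_pos hd0).2 hTd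
  have hnoise : 0 ≤ kalmanGain A G R T * R * (kalmanGain A G R T)ᵀ :=
    (posSemidef_mul_mul_transpose hR.posSemidef _).nonneg
  calc filterMatrix A G R T * T * (filterMatrix A G R T)ᵀ
      = T - C * Cᵀ - kalmanGain A G R T * R * (kalmanGain A G R T)ᵀ := by
        rw [sub_sub, eq_sub_iff_add_eq']
        exact hT.riccati.symm
    _ ≤ T - d⁻¹ • T := (sub_le_self _ hnoise).trans (sub_le_sub_left hdT _)
    _ = (1 - d⁻¹) • T := by rw [sub_smul, one_smul]

lemma IsSteadyStateCov.le (hS : IsSteadyStateCov A C G R S) (hT : IsSteadyStateCov A C G R T)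
    (hR : R.PosDef) (hC : IsUnit C) : S ≤ T := by
  obtain ⟨c, hc, hcT⟩ := exists_le_smul_of_posDef
    (hS.posSemidef.isHermitian.sub hT.posSemidef.isHermitian) (hT.posDef hR hC)
  obtain ⟨q, hq0, hq1, hqT⟩ := hT.exists_filterMatrix_mul_mul_le hR hC
  have hiter : ∀ k : ℕ, S - T ≤ (c * q ^ k) • T := fun k => by
    induction k with
    | zero => simpa using hcT
    | succ k ih =>
      calc S - T ≤ filterMatrix A G R T * (S - T) * (filterMatrix A G R T)ᵀ := hS.sub_le hT hR
        _ ≤ filterMatrix A G R T * ((c * q ^ k) • T) * (filterMatrix A G R T)ᵀ :=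
            mul_mul_transpose_mono ih _
        _ = (c * q ^ k) • (filterMatrix A G R T * T * (filterMatrix A G R T)ᵀ) := by
            rw [Matrix.mul_smul, Matrix.smul_mul]
        _ ≤ (c * q ^ k) • q • T := smul_le_smul_of_nonneg_left hqT (by positivity)
        _ = (c * q ^ (k + 1)) • T := by rw [smul_smul, pow_succ, mul_assoc]
  have hlim : Tendsto (fun k : ℕ => (c * q ^ k) • T) atTop (𝓝 ((c * 0) • T)) :=
    ((tendsto_pow_atTop_nhds_zero_of_lt_one hq0 hq1).const_mul c).smul_const T
  rw [mul_zero, zero_smul] at hlim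
  exact sub_nonpos.1 (ge_of_tendsto' hlim hiter)

lemma existsUnique_isSteadyStateCov (hR : R.PosDef) (hC : IsUnit C)
    {L : Matrix (Fin N) (Fin M) ℝ} (hL : L * G = A) : ∃! S, IsSteadyStateCov A C G R S :=
  have ⟨S, hS⟩ := exists_isSteadyStateCov hR hL
  ⟨S, hS, fun _ hT => (hT.le hS hR hC).antisymm (hS.le hT hR hC)⟩

end Riccati

section LeastSquares

variable {m n : Type*} [Fintype m] [DecidableEq m] [Fintype n]

/-- The information matrix `Gᵀ R⁻¹ G` that an observation `y = G x + v` with error covariance `R`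
carries about `x`. -/
noncomputable def informationMatrix (G : Matrix m n ℝ) (R : Matrix m m ℝ) : Matrix n n ℝ :=
  Gᵀ * R⁻¹ * G

variable {G : Matrix m n ℝ} {R : Matrix m m ℝ}

lemma informationMatrix_posDef (hR : R.PosDef) (hG : Function.Injective G.mulVec) :
    (informationMatrix G R).PosDef := by
  simpa [informationMatrix] using hR.inv.conjTranspose_mul_mul_same hG

variable [DecidableEq n]

/-- The matrix of the generalized (that is, weighted by `R⁻¹`) least squares estimator of `x` from
`y = G x + v`. -/
noncomputable def glsEstimator (G : Matrix m n ℝ) (R : Matrix m m ℝ) : Matrix n m ℝ :=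
  (informationMatrix G R)⁻¹ * Gᵀ * R⁻¹

lemma isUnit_det_informationMatrix (hR : R.PosDef) (hG : Function.Injective G.mulVec) :
    IsUnit (informationMatrix G R).det :=
  (Matrix.isUnit_iff_isUnit_det _).1 (informationMatrix_posDef hR hG).isUnit

lemma informationMatrix_smul_inv {c : ℝ} (hc : c ≠ 0) (hR : R.PosDef)
    (hG : Function.Injective G.mulVec) :
    (informationMatrix G (c • R))⁻¹ = c • (informationMatrix G R)⁻¹ := by
  have hRinv : (c • R)⁻¹ = c⁻¹ • R⁻¹ :=
    Matrix.inv_smul' R (Units.mk0 c hc) ((Matrix.isUnit_iff_isUnit_det _).1 hR.isUnit)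
  have hscale : informationMatrix G (c • R) = c⁻¹ • informationMatrix G R := by
    rw [informationMatrix, informationMatrix, hRinv, Matrix.mul_smul, Matrix.smul_mul]
  rw [hscale]
  exact Matrix.inv_smul' _ (Units.mk0 c hc)⁻¹ (isUnit_det_informationMatrix hR hG)

lemma glsEstimator_mul (hR : R.PosDef) (hG : Function.Injective G.mulVec) :
    glsEstimator G R * G = 1 := by
  rw [glsEstimator, Matrix.mul_assoc, Matrix.mul_assoc, ← Matrix.mul_assoc Gᵀ]
  exact Matrix.nonsing_inv_mul _ (isUnit_det_informationMatrix hR hG)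

lemma glsEstimator_mul_mul_transpose (hR : R.PosDef) (hG : Function.Injective G.mulVec) :
    glsEstimator G R * R * (glsEstimator G R)ᵀ = (informationMatrix G R)⁻¹ := by
  have hHR : glsEstimator G R * R = (informationMatrix G R)⁻¹ * Gᵀ :=
    Matrix.nonsing_inv_mul_cancel_right _ _ ((Matrix.isUnit_iff_isUnit_det _).1 hR.isUnit)
  rw [hHR, Matrix.mul_assoc, ← Matrix.transpose_mul, glsEstimator_mul hR hG, Matrix.transpose_one,
    Matrix.mul_one]

end LeastSquares

section Collapse

open scoped MatrixOrder

variable {N M : ℕ} {A C : Matrix (Fin N) (Fin N) ℝ}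

lemma mul_glsEstimator_mul {G : Matrix (Fin M) (Fin N) ℝ} {R : Matrix (Fin M) (Fin M) ℝ}
    (hR : R.PosDef) (hG : Function.Injective G.mulVec) : A * glsEstimator G R * G = A := by
  rw [Matrix.mul_assoc, glsEstimator_mul hR hG, Matrix.mul_one]

lemma IsSteadyStateCov.le_add_informationMatrix_inv {S : Matrix (Fin N) (Fin N) ℝ}
    {G : Matrix (Fin M) (Fin N) ℝ} {R : Matrix (Fin M) (Fin M) ℝ}
    (hS : IsSteadyStateCov A C G R S) (hR : R.PosDef) (hG : Function.Injective G.mulVec) :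
    S ≤ C * Cᵀ + A * (informationMatrix G R)⁻¹ * Aᵀ := by
  refine (hS.le_of_mul_eq hR (mul_glsEstimator_mul hR hG)).trans_eq ?_
  rw [← glsEstimator_mul_mul_transpose hR hG, Matrix.transpose_mul]
  simp only [Matrix.mul_assoc]

/-- Both sides solve `F * (1 + S * Γ) = A`, where `Γ` is the information matrix. -/
lemma filterMatrix_eq {S : Matrix (Fin N) (Fin N) ℝ} {G : Matrix (Fin M) (Fin N) ℝ}
    {R : Matrix (Fin M) (Fin M) ℝ} (hR : R.PosDef) (hG : Function.Injective G.mulVec)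
    (hS : S.PosSemidef) : filterMatrix A G R S =
      A * (informationMatrix G R)⁻¹ * ((informationMatrix G R)⁻¹ + S)⁻¹ := by
  have hΓ := isUnit_det_informationMatrix hR hG
  have hsum := (Matrix.isUnit_iff_isUnit_det _).1
    ((informationMatrix_posDef hR hG).inv.add_posSemidef hS).isUnit
  have hpush : G * (1 + S * informationMatrix G R) = (G * S * Gᵀ + R) * (R⁻¹ * G) := by
    rw [Matrix.add_mul, Matrix.mul_nonsing_inv_cancel_left _ _
      ((Matrix.isUnit_iff_isUnit_det _).1 hR.isUnit), informationMatrix]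
    simp only [Matrix.mul_add, Matrix.mul_one, Matrix.mul_assoc, add_comm]
  have hF : filterMatrix A G R S * (1 + S * informationMatrix G R) = A := by
    rw [filterMatrix, Matrix.sub_mul, Matrix.mul_assoc (kalmanGain A G R S), hpush,
      ← Matrix.mul_assoc, kalmanGain_mul_innovationCov hR hS, Matrix.mul_add, Matrix.mul_one,
      informationMatrix]
    simp only [Matrix.mul_assoc, add_sub_cancel_right]
  have hfactor : 1 + S * informationMatrix G R =
      ((informationMatrix G R)⁻¹ + S) * informationMatrix G R := by
    rw [Matrix.add_mul, Matrix.nonsing_inv_mul _ hΓ]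
  rw [hfactor, ← Matrix.mul_assoc] at hF
  conv_rhs => rw [← hF]
  rw [Matrix.mul_nonsing_inv_cancel_right _ _ hΓ, Matrix.mul_nonsing_inv_cancel_right _ _ hsum]

lemma limsup_mul_norm_lt_top_of_isBigO_inv {E : Type*} [SeminormedAddCommGroup E] {f : ℕ → E}
    (hf : f =O[atTop] fun k : ℕ => (k : ℝ)⁻¹) :
    limsup (fun k : ℕ => (((k : ℝ) * ‖f k‖ : ℝ) : EReal)) atTop < ⊤ := by
  obtain ⟨c, hc⟩ := hf.bound
  refine (limsup_le_of_le (by isBoundedDefault) ?_).trans_lt (EReal.coe_lt_top c)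
  filter_upwards [hc, eventually_gt_atTop 0] with k hk hk0
  have hk0' : (0 : ℝ) < k := by exact_mod_cast hk0
  rw [EReal.coe_le_coe_iff]
  calc (k : ℝ) * ‖f k‖ ≤ k * (c * ‖(k : ℝ)⁻¹‖) := by gcongr
    _ = c := by
      rw [Real.norm_of_nonneg (inv_nonneg.2 hk0'.le)]
      field_simp

lemma tendsto_of_le_of_le_add {ι n : Type*} [Finite n] {l : Filter ι} {P : Matrix n n ℝ}
    {S E : ι → Matrix n n ℝ} (hlower : ∀ᶠ k in l, P ≤ S k) (hupper : ∀ᶠ k in l, S k ≤ P + E k)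
    (hE : Tendsto E l (𝓝 0)) : Tendsto S l (𝓝 P) := by
  cases nonempty_fintype n
  have htrace : Tendsto (fun k => (E k).trace) l (𝓝 0) := by
    have hcont : Continuous fun B : Matrix n n ℝ => B.trace := by fun_prop
    simpa [Function.comp_def] using (hcont.tendsto 0).comp hE
  refine tendsto_iff_norm_sub_tendsto_zero.2 (squeeze_zero_norm' ?_ htrace)
  filter_upwards [hlower, hupper] with k hPS hSE
  have hmono := monotone_re_trace hSE
  have hnorm := norm_sub_le_re_trace_sub hPS
  simp only [RCLike.re_to_real, Matrix.trace_add] at hmono hnorm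
  rw [norm_norm]
  linarith

variable {G : ∀ M : ℕ, Matrix (Fin M) (Fin N) ℝ} {R : ∀ M : ℕ, Matrix (Fin M) (Fin M) ℝ}

lemma filterCollapses_of_le_of_le_add (hC : IsUnit C) (hR : ∀ M, (R M).PosDef)
    (hG : ∀ᶠ M in atTop, Function.Injective (G M).mulVec)
    (hinfo : (fun M => (informationMatrix (G M) (R M))⁻¹) =O[atTop] fun M : ℕ => (M : ℝ)⁻¹)
    {S : ℕ → Matrix (Fin N) (Fin N) ℝ} (hlower : ∀ᶠ M in atTop, C * Cᵀ ≤ S M)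
    (hupper : ∀ᶠ M in atTop,
      S M ≤ C * Cᵀ + A * (informationMatrix (G M) (R M))⁻¹ * Aᵀ) :
    FilterCollapses A C G R S := by
  have hCC := posDef_mul_transpose_self_of_isUnit hC
  have hinfo0 : Tendsto (fun M => (informationMatrix (G M) (R M))⁻¹) atTop (𝓝 0) :=
    hinfo.trans_tendsto tendsto_inv_atTop_nhds_zero_nat
  have hS : Tendsto S atTop (𝓝 (C * Cᵀ)) :=
    tendsto_of_le_of_le_add hlower hupper
      (by simpa using (hinfo0.const_mul A).mul_const Aᵀ)
  have hinv : Tendsto (fun M => ((informationMatrix (G M) (R M))⁻¹ + S M)⁻¹) atTop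
      (𝓝 (C * Cᵀ)⁻¹) :=
    (continuousAt_nonsing_inv hCC.isUnit).tendsto.comp (by simpa using hinfo0.add hS)
  have hprod : (fun M => A * (informationMatrix (G M) (R M))⁻¹ *
      ((informationMatrix (G M) (R M))⁻¹ + S M)⁻¹) =O[atTop] fun M : ℕ => (M : ℝ)⁻¹ := by
    simpa using ((isBigO_const_const A (one_ne_zero (α := ℝ)) atTop).mul hinfo).mul
      (hinv.isBigO_one ℝ)
  have hF : (fun M => filterMatrix A (G M) (R M) (S M)) =O[atTop] fun M : ℕ => (M : ℝ)⁻¹ := by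
    refine hprod.congr' ?_ EventuallyEq.rfl
    filter_upwards [hlower, hG] with M hM hGM
    exact (filterMatrix_eq (hR M) hGM (posDef_of_le hCC hM).posSemidef).symm
  exact ⟨hS, hF.trans_tendsto tendsto_inv_atTop_nhds_zero_nat,
    limsup_mul_norm_lt_top_of_isBigO_inv hF⟩

end Collapse

section CovarianceMatrix

variable {Ω m n : Type*} {mΩ : MeasurableSpace Ω} {μ : Measure Ω}

/-- The covariance matrix of a random vector. -/
noncomputable def covarianceMatrix (μ : Measure Ω) (X : Ω → n → ℝ) : Matrix n n ℝ :=
  Matrix.of fun i j => cov[fun ω => X ω i, fun ω => X ω j; μ]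

lemma covarianceMatrix_congr_ae {X Y : Ω → n → ℝ} (h : X =ᵐ[μ] Y) :
    covarianceMatrix μ X = covarianceMatrix μ Y := by
  have hcoord : ∀ i, (fun ω => X ω i) =ᵐ[μ] fun ω => Y ω i := fun i =>
    h.mono fun ω hω => congrFun hω i
  ext i j
  simp only [covarianceMatrix, Matrix.of_apply, covariance, integral_congr_ae (hcoord _)]
  refine integral_congr_ae ?_
  filter_upwards [h] with ω hω
  rw [hω]

lemma covarianceMatrix_eq_integral {X : Ω → n → ℝ} (hX : ∀ i, ∫ ω, X ω i ∂μ = 0) :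
    covarianceMatrix μ X = Matrix.of fun i j => ∫ ω, X ω i * X ω j ∂μ := by
  simp only [covarianceMatrix, covariance, hX, sub_zero]

variable [Fintype n] [IsFiniteMeasure μ] {X Y : Ω → n → ℝ}

lemma covariance_dotProduct (hX : MemLp X 2 μ) (a b : n → ℝ) :
    cov[fun ω => a ⬝ᵥ X ω, fun ω => b ⬝ᵥ X ω; μ] = a ⬝ᵥ covarianceMatrix μ X *ᵥ b := by
  simp only [dotProduct, Matrix.mulVec]
  rw [covariance_fun_sum_fun_sum (fun i => (hX.eval i).const_mul (a i))
    fun i => (hX.eval i).const_mul (b i)]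
  refine Finset.sum_congr rfl fun i _ => ?_
  rw [Finset.mul_sum]
  refine Finset.sum_congr rfl fun j _ => ?_
  rw [covariance_const_mul_left, covariance_const_mul_right, covarianceMatrix, Matrix.of_apply]
  ring

lemma covarianceMatrix_mulVec (hX : MemLp X 2 μ) (B : Matrix m n ℝ) :
    covarianceMatrix μ (fun ω => B *ᵥ X ω) = B * covarianceMatrix μ X * Bᵀ := by
  ext i j
  rw [Matrix.mul_assoc]
  exact covariance_dotProduct hX (B i) (B j)

lemma covarianceMatrix_posSemidef (hX : MemLp X 2 μ) : (covarianceMatrix μ X).PosSemidef := by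
  refine .of_dotProduct_mulVec_nonneg (Matrix.ext fun i j => covariance_comm _ _) fun a => ?_
  have haX : AEMeasurable (fun ω => a ⬝ᵥ X ω) μ :=
    Finset.aemeasurable_fun_sum _ fun i _ =>
      (hX.eval i).aestronglyMeasurable.aemeasurable.const_mul _
  rw [star_trivial, ← covariance_dotProduct hX, covariance_self haX]
  exact variance_nonneg _ _

end CovarianceMatrix

section CondError

variable {Ω E : Type*} {𝓕 mΩ : MeasurableSpace Ω} {μ : Measure Ω}
  [NormedAddCommGroup E] [NormedSpace ℝ E]

/-- The error `X - E[X | 𝓕]` of the best mean square prediction of `X` from the information `𝓕`. -/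
noncomputable def condError (μ : Measure Ω) (𝓕 : MeasurableSpace Ω) (X : Ω → E) : Ω → E :=
  X - μ[X | 𝓕]

lemma condError_eq_self {X : Ω → E} (hX : μ[X | 𝓕] =ᵐ[μ] 0) : condError μ 𝓕 X =ᵐ[μ] X := by
  filter_upwards [hX] with ω hω
  simp [condError, hω]

variable [CompleteSpace E]

lemma condError_congr_ae {X Y : Ω → E} (h : X =ᵐ[μ] Y) :
    condError μ 𝓕 X =ᵐ[μ] condError μ 𝓕 Y :=
  h.sub (condExp_congr_ae h)

lemma condError_add {X Y : Ω → E} (hX : Integrable X μ) (hY : Integrable Y μ) :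
    condError μ 𝓕 (X + Y) =ᵐ[μ] condError μ 𝓕 X + condError μ 𝓕 Y := by
  filter_upwards [condExp_add hX hY 𝓕] with ω hω
  simp only [condError, Pi.sub_apply, Pi.add_apply, hω]
  abel

lemma memLp_condError {X : Ω → E} (hX : MemLp X 2 μ) : MemLp (condError μ 𝓕 X) 2 μ :=
  hX.sub (hX.condExp one_le_two)

lemma condExp_condError (h𝓕 : 𝓕 ≤ mΩ) [SigmaFinite (μ.trim h𝓕)] {X : Ω → E}
    (hX : Integrable X μ) : μ[condError μ 𝓕 X | 𝓕] =ᵐ[μ] 0 := by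
  filter_upwards [condExp_sub hX integrable_condExp 𝓕] with ω hω
  rw [condError, hω, condExp_of_stronglyMeasurable h𝓕 stronglyMeasurable_condExp
    integrable_condExp]
  simp

lemma covariance_eq_zero_of_condExp_eq_zero [IsProbabilityMeasure μ] (h𝓕 : 𝓕 ≤ mΩ) {ξ ζ : Ω → ℝ}
    (hξ : MemLp ξ 2 μ) (hζ : MemLp ζ 2 μ) (hξ0 : μ[ξ | 𝓕] =ᵐ[μ] 0)
    (hζm : StronglyMeasurable[𝓕] ζ) : cov[ξ, ζ; μ] = 0 := by
  have hmean : μ[ξ] = 0 := by rw [← integral_condExp h𝓕, integral_congr_ae hξ0]; simp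
  have hprod : μ[ξ * ζ | 𝓕] =ᵐ[μ] 0 := by
    filter_upwards [condExp_mul_of_stronglyMeasurable_right hζm (hξ.integrable_mul hζ)
      (hξ.integrable one_le_two), hξ0] with ω hω hω0
    simp [hω, hω0]
  rw [covariance_eq_sub hξ hζ, hmean, ← integral_condExp h𝓕, integral_congr_ae hprod]
  simp

variable {m n : Type*} [Fintype n] {X W : Ω → n → ℝ}

lemma memLp_mulVec [Fintype m] (B : Matrix m n ℝ) {p : ENNReal} (hX : MemLp X p μ) :
    MemLp (fun ω => B *ᵥ X ω) p μ :=
  (Matrix.mulVecLin B).toContinuousLinearMap.comp_memLp' hX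

lemma stronglyMeasurable_mulVec (B : Matrix m n ℝ)
    (h𝓕 : MeasurableSpace.comap X inferInstance ≤ 𝓕) :
    StronglyMeasurable[𝓕] fun ω => B *ᵥ X ω :=
  (Continuous.matrix_mulVec continuous_const continuous_id).comp_stronglyMeasurable
    ((comap_measurable X).mono h𝓕 le_rfl).stronglyMeasurable

lemma mulVec_condExp [Fintype m] (B : Matrix m n ℝ) (hX : Integrable X μ) :
    (fun ω => B *ᵥ μ[X | 𝓕] ω) =ᵐ[μ] μ[fun ω => B *ᵥ X ω | 𝓕] :=
  (Matrix.mulVecLin B).toContinuousLinearMap.comp_condExp_comm hX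

lemma mulVec_condError [Fintype m] (B : Matrix m n ℝ) (hX : Integrable X μ) :
    (fun ω => B *ᵥ condError μ 𝓕 X ω) =ᵐ[μ] condError μ 𝓕 fun ω => B *ᵥ X ω := by
  filter_upwards [mulVec_condExp (𝓕 := 𝓕) B hX] with ω hω
  simp only [condError, Pi.sub_apply, Matrix.mulVec_sub, hω]

lemma condExp_eval (hX : Integrable X μ) (i : n) :
    (fun ω => μ[X | 𝓕] ω i) =ᵐ[μ] μ[fun ω => X ω i | 𝓕] :=
  (ContinuousLinearMap.proj (R := ℝ) (φ := fun _ : n => ℝ) i).comp_condExp_comm hX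

lemma covarianceMatrix_add_of_condExp_eq_zero [IsProbabilityMeasure μ] (h𝓕 : 𝓕 ≤ mΩ)
    (hX : MemLp X 2 μ) (hW : MemLp W 2 μ) (hX0 : μ[X | 𝓕] =ᵐ[μ] 0)
    (hWm : StronglyMeasurable[𝓕] W) :
    covarianceMatrix μ (X + W) = covarianceMatrix μ X + covarianceMatrix μ W := by
  have huncorr : ∀ i j, cov[fun ω => X ω i, fun ω => W ω j; μ] = 0 := fun i j => by
    refine covariance_eq_zero_of_condExp_eq_zero h𝓕 (hX.eval i) (hW.eval j) ?_
      ((continuous_apply j).comp_stronglyMeasurable hWm)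
    filter_upwards [condExp_eval (𝓕 := 𝓕) (hX.integrable one_le_two) i, hX0] with ω hi h0
    rw [← hi, h0]
    rfl
  ext i j
  have hadd : ∀ k, (fun ω => (X + W) ω k) = (fun ω => X ω k) + fun ω => W ω k := fun k => rfl
  simp only [covarianceMatrix, Matrix.of_apply, Matrix.add_apply, hadd]
  rw [covariance_add_left (hX.eval i) (hW.eval i) ((hX.eval j).add (hW.eval j)),
    covariance_add_right (hX.eval i) (hX.eval j) (hW.eval j),
    covariance_add_right (hW.eval i) (hX.eval j) (hW.eval j), huncorr,
    covariance_comm (fun ω => W ω i), huncorr]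
  ring

/-- `W` is its own innovation and uncorrelated with the error in predicting `X`. -/
lemma covarianceMatrix_condError_add [IsProbabilityMeasure μ] {𝓖 : MeasurableSpace Ω}
    (h𝓕𝓖 : 𝓕 ≤ 𝓖) (h𝓖 : 𝓖 ≤ mΩ) (hW : MemLp W 2 μ) (hX : MemLp X 2 μ) (hW0 : μ[W | 𝓖] =ᵐ[μ] 0)
    (hXm : StronglyMeasurable[𝓖] X) :
    covarianceMatrix μ (condError μ 𝓕 (W + X)) =
      covarianceMatrix μ W + covarianceMatrix μ (condError μ 𝓕 X) := by
  have hW0' : μ[W | 𝓕] =ᵐ[μ] 0 :=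
    (condExp_condExp_of_le h𝓕𝓖 h𝓖).symm.trans ((condExp_congr_ae hW0).trans (by simp))
  have herr : condError μ 𝓕 (W + X) =ᵐ[μ] W + condError μ 𝓕 X :=
    (condError_add (hW.integrable one_le_two) (hX.integrable one_le_two)).trans
      ((condError_eq_self hW0').add EventuallyEq.rfl)
  rw [covarianceMatrix_congr_ae herr]
  exact covarianceMatrix_add_of_condExp_eq_zero h𝓖 hW (memLp_condError hX) hW0
    (hXm.sub (stronglyMeasurable_condExp.mono h𝓕𝓖))

open scoped MatrixOrder in
lemma covarianceMatrix_condError_le [IsProbabilityMeasure μ] (h𝓕 : 𝓕 ≤ mΩ)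
    (hX : MemLp X 2 μ) (hW : MemLp W 2 μ) (hWm : StronglyMeasurable[𝓕] W) :
    covarianceMatrix μ (condError μ 𝓕 X) ≤ covarianceMatrix μ (X - W) := by
  have hE : MemLp (μ[X | 𝓕] - W) 2 μ := (hX.condExp one_le_two).sub hW
  have hsplit : X - W = condError μ 𝓕 X + (μ[X | 𝓕] - W) := by rw [condError]; abel
  rw [hsplit, covarianceMatrix_add_of_condExp_eq_zero h𝓕 (memLp_condError hX) hE
    (condExp_condError h𝓕 (hX.integrable one_le_two)) (stronglyMeasurable_condExp.sub hWm)]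
  exact le_add_of_nonneg_right (covarianceMatrix_posSemidef hE).nonneg

end CondError

section ProductLaw

variable {Ω n : Type*} {mΩ : MeasurableSpace Ω} {μ : Measure Ω} [Fintype n]
  {ν : Measure ℝ} [IsProbabilityMeasure ν] {X : Ω → n → ℝ}

lemma hasLaw_eval_of_hasLaw_pi (hX : HasLaw X (Measure.pi fun _ => ν) μ) (i : n) :
    HasLaw (fun ω => X ω i) ν μ :=
  (measurePreserving_eval (fun _ : n => ν) i).hasLaw.comp hX

lemma memLp_of_hasLaw_pi (hX : HasLaw X (Measure.pi fun _ => ν) μ) {p : ENNReal}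
    (hν : MemLp id p ν) : MemLp X p μ := by
  refine .of_eval fun i => ?_
  have h := hasLaw_eval_of_hasLaw_pi hX i
  rw [← h.map_eq] at hν
  exact hν.comp_of_map h.aemeasurable

lemma integral_of_hasLaw_pi (hX : HasLaw X (Measure.pi fun _ => ν) μ) (hν : Integrable id ν) :
    μ[X] = fun _ => ∫ a, a ∂ν := by
  have hint := memLp_one_iff_integrable.1 (memLp_of_hasLaw_pi hX (memLp_one_iff_integrable.2 hν))
  ext i
  rw [eval_integral hint.eval, (hasLaw_eval_of_hasLaw_pi hX i).integral_eq]

lemma covarianceMatrix_of_hasLaw_pi [DecidableEq n] (hX : HasLaw X (Measure.pi fun _ => ν) μ)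
    (hν : MemLp id 2 ν) : covarianceMatrix μ X = Var[id; ν] • (1 : Matrix n n ℝ) := by
  have hμ : IsProbabilityMeasure μ := hX.isProbabilityMeasure
  have hL2 := memLp_of_hasLaw_pi hX hν
  have hindep : iIndepFun (fun i ω => X ω i) μ := by
    rw [iIndepFun_iff_map_fun_eq_pi_map fun i => (hL2.eval i).aestronglyMeasurable.aemeasurable]
    simp only [(hasLaw_eval_of_hasLaw_pi hX _).map_eq]
    exact hX.map_eq
  ext i j
  rw [covarianceMatrix, Matrix.of_apply, Matrix.smul_apply, smul_eq_mul]
  rcases eq_or_ne i j with rfl | hij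
  · rw [covariance_self (hL2.eval i).aestronglyMeasurable.aemeasurable,
      (hasLaw_eval_of_hasLaw_pi hX i).variance_eq, Matrix.one_apply_eq, mul_one]
  · rw [(hindep.indepFun hij).covariance_eq_zero (hL2.eval i) (hL2.eval j),
      Matrix.one_apply_ne hij, mul_zero]

end ProductLaw

section Prediction

open scoped MatrixOrder

variable {N M : ℕ} {Ω : Type*} {mΩ : MeasurableSpace Ω} {μ : Measure Ω}
  {A C : Matrix (Fin N) (Fin N) ℝ} {G : Matrix (Fin M) (Fin N) ℝ} {R : Matrix (Fin M) (Fin M) ℝ}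
  {σ : ℝ} {x w : ℤ → Ω → Fin N → ℝ} {y v : ℤ → Ω → Fin M → ℝ}

/-- A square integrable realization, with time running over `ℤ`, of the dynamic factor model
`x (t+1) = A x t + C w (t+1)`, `y t = G x t + v t`, in which the shocks have covariance `1` and are
unpredictable from the current state and the observables so far, and the measurement errors have
covariance `R`. -/
structure IsSecondOrderDFM (μ : Measure Ω) (A C : Matrix (Fin N) (Fin N) ℝ)
    (G : Matrix (Fin M) (Fin N) ℝ) (R : Matrix (Fin M) (Fin M) ℝ)
    (x w : ℤ → Ω → Fin N → ℝ) (y v : ℤ → Ω → Fin M → ℝ) : Prop where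
  measurable_x : ∀ t, Measurable (x t)
  measurable_y : ∀ t, Measurable (y t)
  memLp_x : ∀ t, MemLp (x t) 2 μ
  memLp_w : ∀ t, MemLp (w t) 2 μ
  memLp_v : ∀ t, MemLp (v t) 2 μ
  transition : ∀ t, ∀ᵐ ω ∂μ, x (t + 1) ω = A *ᵥ x t ω + C *ᵥ w (t + 1) ω
  measurement : ∀ t, ∀ᵐ ω ∂μ, y t ω = G *ᵥ x t ω + v t ω
  covarianceMatrix_w : ∀ t, covarianceMatrix μ (w t) = 1
  covarianceMatrix_v : ∀ t, covarianceMatrix μ (v t) = R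
  condExp_w : ∀ t,
    μ[w (t + 1) | pastObs y (t + 1) ⊔ MeasurableSpace.comap (x t) inferInstance] =ᵐ[μ] 0

lemma pastObs_le (hy : ∀ t, Measurable (y t)) (t : ℤ) : pastObs y t ≤ mΩ :=
  iSup_le fun s => (hy s).comap_le

lemma comap_le_pastObs (y : ℤ → Ω → Fin M → ℝ) (s : ℤ) :
    MeasurableSpace.comap (y s) inferInstance ≤ pastObs y (s + 1) :=
  le_iSup (fun r : Set.Iio (s + 1) => MeasurableSpace.comap (y r) inferInstance)
    ⟨s, lt_add_one s⟩

lemma predictionCov_eq_covarianceMatrix [IsFiniteMeasure μ] (hy : ∀ t, Measurable (y t)) {t : ℤ}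
    (hx : Integrable (x t) μ) :
    predictionCov μ x y t = covarianceMatrix μ (condError μ (pastObs y t) (x t)) := by
  have herr : predictionError μ x y t =ᵐ[μ] condError μ (pastObs y t) (x t) := by
    filter_upwards [ae_all_iff.2 fun i => condExp_eval (𝓕 := pastObs y t) hx i] with ω hω
    ext i
    rw [predictionError, ← hω i]
    rfl
  have hmean : ∀ i, ∫ ω, predictionError μ x y t ω i ∂μ = 0 := fun i => by
    simp only [predictionError]
    rw [integral_sub (hx.eval i) integrable_condExp, integral_condExp (pastObs_le hy t), sub_self]
  rw [← covarianceMatrix_congr_ae herr, covarianceMatrix_eq_integral hmean]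
  rfl

lemma IsStationaryDFM.indepFun_past (h : IsStationaryDFM μ A C G σ x w y v) (s : ℤ) :
    IndepFun (fun ω => ((fun r : Set.Iio (s + 1) => y r ω), x s ω)) (w (s + 1)) μ := by
  let φ : (Set.Iic s → Fin N → ℝ) × (ℤ → Fin M → ℝ) →
      (Set.Iio (s + 1) → Fin M → ℝ) × (Fin N → ℝ) := fun p =>
    (fun r => G *ᵥ p.1 ⟨r, Int.lt_add_one_iff.1 r.2⟩ + p.2 r, p.1 ⟨s, Set.self_mem_Iic⟩)
  let ψ : (Set.Ioi s → Fin N → ℝ) → Fin N → ℝ := fun p => p ⟨s + 1, lt_add_one s⟩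
  have hφ : Measurable φ := by
    refine Measurable.prodMk (measurable_pi_iff.2 fun r => ?_) (by fun_prop)
    exact ((Continuous.matrix_mulVec continuous_const continuous_id).measurable.comp
      (by fun_prop)).add (by fun_prop)
  have hψ : Measurable ψ := measurable_pi_apply _
  refine ((h.causal s).comp hφ hψ).congr ?_ EventuallyEq.rfl
  filter_upwards [ae_all_iff.2 fun r : Set.Iio (s + 1) => h.measurement r] with ω hω
  exact Prod.ext (funext fun r => (hω r).symm) rfl

variable [IsProbabilityMeasure μ]

lemma IsSecondOrderDFM.predictionCov_eq (h : IsSecondOrderDFM μ A C G R x w y v) (s : ℤ) :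
    predictionCov μ x y (s + 1) = C * Cᵀ
      + A * covarianceMatrix μ (condError μ (pastObs y (s + 1)) (x s)) * Aᵀ := by
  set 𝓖 := pastObs y (s + 1) ⊔ MeasurableSpace.comap (x s) inferInstance
  have h𝓖 : 𝓖 ≤ mΩ := sup_le (pastObs_le h.measurable_y _) (h.measurable_x s).comap_le
  have hint : ∀ {ξ : Ω → Fin N → ℝ}, MemLp ξ 2 μ → Integrable ξ μ := fun hξ =>
    hξ.integrable one_le_two
  have hstate : x (s + 1) =ᵐ[μ] (fun ω => C *ᵥ w (s + 1) ω) + fun ω => A *ᵥ x s ω :=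
    (h.transition s).mono fun ω hω => hω.trans (add_comm _ _)
  have hshock : μ[fun ω => C *ᵥ w (s + 1) ω | 𝓖] =ᵐ[μ] 0 := by
    filter_upwards [mulVec_condExp (𝓕 := 𝓖) C (hint (h.memLp_w (s + 1))), h.condExp_w s]
      with ω hω h0
    rw [← hω, h0, Pi.zero_apply, Matrix.mulVec_zero]
  rw [predictionCov_eq_covarianceMatrix h.measurable_y (hint (h.memLp_x _)),
    covarianceMatrix_congr_ae (condError_congr_ae hstate),
    covarianceMatrix_condError_add le_sup_left h𝓖 (memLp_mulVec C (h.memLp_w _))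
      (memLp_mulVec A (h.memLp_x s)) hshock (stronglyMeasurable_mulVec A le_sup_right),
    covarianceMatrix_mulVec (h.memLp_w _), h.covarianceMatrix_w, Matrix.mul_one,
    ← covarianceMatrix_congr_ae (mulVec_condError A (hint (h.memLp_x s))),
    covarianceMatrix_mulVec (memLp_condError (h.memLp_x s))]

lemma IsSecondOrderDFM.covarianceMatrix_condError_le_informationMatrix_inv
    (h : IsSecondOrderDFM μ A C G R x w y v) (hR : R.PosDef)
    (hG : Function.Injective G.mulVec) (s : ℤ) :
    covarianceMatrix μ (condError μ (pastObs y (s + 1)) (x s)) ≤ (informationMatrix G R)⁻¹ := by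
  set H := glsEstimator G R
  have hestimate : (fun ω => H *ᵥ y s ω) =ᵐ[μ] x s + fun ω => H *ᵥ v s ω := by
    filter_upwards [h.measurement s] with ω hω
    rw [hω, Matrix.mulVec_add, Matrix.mulVec_mulVec, glsEstimator_mul hR hG, Matrix.one_mulVec,
      Pi.add_apply]
  have herror : x s - (fun ω => H *ᵥ y s ω) =ᵐ[μ] fun ω => (-H) *ᵥ v s ω := by
    filter_upwards [hestimate] with ω hω
    rw [Pi.sub_apply, hω, Pi.add_apply, Matrix.neg_mulVec]
    abel
  have hL2 : MemLp (fun ω => H *ᵥ y s ω) 2 μ :=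
    (memLp_congr_ae hestimate).2 ((h.memLp_x s).add (memLp_mulVec H (h.memLp_v s)))
  calc covarianceMatrix μ (condError μ (pastObs y (s + 1)) (x s))
      ≤ covarianceMatrix μ (x s - fun ω => H *ᵥ y s ω) :=
        covarianceMatrix_condError_le (pastObs_le h.measurable_y _) (h.memLp_x s) hL2
          (stronglyMeasurable_mulVec H (comap_le_pastObs y s))
    _ = H * R * Hᵀ := by
        rw [covarianceMatrix_congr_ae herror, covarianceMatrix_mulVec (h.memLp_v s),
          h.covarianceMatrix_v, Matrix.transpose_neg, Matrix.mul_neg, Matrix.neg_mul,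
          Matrix.neg_mul, neg_neg]
    _ = (informationMatrix G R)⁻¹ := glsEstimator_mul_mul_transpose hR hG

lemma IsSecondOrderDFM.mul_transpose_le_predictionCov
    (h : IsSecondOrderDFM μ A C G R x w y v) (t : ℤ) : C * Cᵀ ≤ predictionCov μ x y t := by
  obtain ⟨s, rfl⟩ : ∃ s, t = s + 1 := ⟨t - 1, by ring⟩
  rw [h.predictionCov_eq]
  exact le_add_of_nonneg_right (posSemidef_mul_mul_transpose
    (covarianceMatrix_posSemidef (memLp_condError (h.memLp_x s))) A).nonneg

lemma IsSecondOrderDFM.predictionCov_le_add_informationMatrix_inv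
    (h : IsSecondOrderDFM μ A C G R x w y v) (hR : R.PosDef)
    (hG : Function.Injective G.mulVec) (t : ℤ) :
    predictionCov μ x y t ≤ C * Cᵀ + A * (informationMatrix G R)⁻¹ * Aᵀ := by
  obtain ⟨s, rfl⟩ : ∃ s, t = s + 1 := ⟨t - 1, by ring⟩
  rw [h.predictionCov_eq]
  exact add_le_add_right (mul_mul_transpose_mono
    (h.covarianceMatrix_condError_le_informationMatrix_inv hR hG s) A) _

lemma IsStationaryDFM.condExp_w (h : IsStationaryDFM μ A C G σ x w y v) (s : ℤ) :
    μ[w (s + 1) | pastObs y (s + 1) ⊔ MeasurableSpace.comap (x s) inferInstance] =ᵐ[μ] 0 := by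
  have hpast : pastObs y (s + 1) ⊔ MeasurableSpace.comap (x s) inferInstance =
      MeasurableSpace.comap (fun ω => ((fun r : Set.Iio (s + 1) => y r ω), x s ω))
        inferInstance := by
    rw [pastObs, ← MeasurableSpace.comap_process_pi fun r : Set.Iio (s + 1) => y r]
    exact (MeasurableSpace.comap_prodMk _ _).symm
  have hlaw : HasLaw (w (s + 1)) (Measure.pi fun _ => gaussianReal 0 1) μ :=
    ⟨(h.measurable_w _).aemeasurable, h.law_w _⟩
  have hindep := ((IndepFun_iff_Indep _ _ _).1 (h.indepFun_past s)).symm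
  rw [← hpast] at hindep
  refine (condExp_indep_eq (h.measurable_w (s + 1)).comap_le
    (sup_le (pastObs_le h.measurable_y _) (h.measurable_x s).comap_le)
    (comap_measurable _).stronglyMeasurable hindep).trans ?_
  rw [integral_of_hasLaw_pi hlaw ((memLp_id_gaussianReal 1).integrable le_rfl),
    integral_id_gaussianReal]
  rfl

lemma IsStationaryDFM.isSecondOrderDFM (h : IsStationaryDFM μ A C G σ x w y v) :
    IsSecondOrderDFM μ A C G (σ ^ 2 • 1) x w y v := by
  have hw : ∀ t, HasLaw (w t) (Measure.pi fun _ => gaussianReal 0 1) μ := fun t =>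
    ⟨(h.measurable_w t).aemeasurable, h.law_w t⟩
  have hv : ∀ t, HasLaw (v t) (Measure.pi fun _ => gaussianReal 0 (σ ^ 2).toNNReal) μ := fun t =>
    ⟨(h.measurable_v t).aemeasurable, h.law_v t⟩
  exact
  { measurable_x := h.measurable_x
    measurable_y := h.measurable_y
    memLp_x := fun t => by
      have := h.gaussian_x t
      have hid : MemLp id 2 (μ.map (x t)) := IsGaussian.memLp_two_id
      exact hid.comp_of_map (h.measurable_x t).aemeasurable
    memLp_w := fun t => memLp_of_hasLaw_pi (hw t) (memLp_id_gaussianReal 2)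
    memLp_v := fun t => memLp_of_hasLaw_pi (hv t) (memLp_id_gaussianReal 2)
    transition := h.transition
    measurement := h.measurement
    covarianceMatrix_w := fun t => by
      rw [covarianceMatrix_of_hasLaw_pi (hw t) (memLp_id_gaussianReal 2), variance_id_gaussianReal,
        NNReal.coe_one, one_smul]
    covarianceMatrix_v := fun t => by
      rw [covarianceMatrix_of_hasLaw_pi (hv t) (memLp_id_gaussianReal 2), variance_id_gaussianReal,
        Real.coe_toNNReal _ (sq_nonneg σ)]
    condExp_w := h.condExp_w }

end Prediction

section FactorModel

variable {N : ℕ} {A : Matrix (Fin N) (Fin N) ℝ} {G : ∀ M : ℕ, Matrix (Fin M) (Fin N) ℝ}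
  {R : ∀ M : ℕ, Matrix (Fin M) (Fin M) ℝ} {σ : ℝ}

lemma FactorModelAssumption.posDef_noise (h : FactorModelAssumption A G R σ) (M : ℕ) :
    (R M).PosDef := by
  rw [h.noise]
  exact Matrix.PosDef.one.smul (pow_pos h.sigma_pos 2)

lemma FactorModelAssumption.informationMatrix_inv_isBigO (h : FactorModelAssumption A G R σ) :
    (fun M => (informationMatrix (G M) (R M))⁻¹) =O[atTop] fun M : ℕ => (M : ℝ)⁻¹ := by
  refine (h.gram_inv_isBigO.of_norm_left.const_smul_left (σ ^ 2)).congr' ?_ EventuallyEq.rfl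
  filter_upwards [h.rank_G] with M hM
  rw [h.noise, informationMatrix_smul_inv (pow_pos h.sigma_pos 2).ne' Matrix.PosDef.one
    (mulVec_injective_of_rank_eq_card (hM.trans (Fintype.card_fin N).symm))]
  simp [informationMatrix]

end FactorModel

theorem mainTheorem3_general {N : ℕ} (A C : Matrix (Fin N) (Fin N) ℝ)
    (G : ∀ M : ℕ, Matrix (Fin M) (Fin N) ℝ) (R : ∀ M : ℕ, Matrix (Fin M) (Fin M) ℝ)
    (hR : ∀ M, (R M).PosDef) (hG : ∀ᶠ M in atTop, (G M).rank = N)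
    (hinfo : (fun M => (informationMatrix (G M) (R M))⁻¹) =O[atTop] fun M : ℕ => (M : ℝ)⁻¹)
    (hC : C.rank = N) :
    (∀ M, (G M).rank = N →
      (∃! S, IsSteadyStateCov A C (G M) (R M) S) ∧
      ∀ S, IsSteadyStateCov A C (G M) (R M) S → S.PosDef) ∧
    (∀ S : ℕ → Matrix (Fin N) (Fin N) ℝ,
      (∀ᶠ M in atTop, IsSteadyStateCov A C (G M) (R M) (S M)) →
      FilterCollapses A C G R S) ∧
    (∀ (Ω : ℕ → Type*) (_ : ∀ M, MeasurableSpace (Ω M)) (μ : ∀ M, Measure (Ω M))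
      (_ : ∀ M, IsProbabilityMeasure (μ M))
      (x w : ∀ M, ℤ → Ω M → Fin N → ℝ) (y v : ∀ M, ℤ → Ω M → Fin M → ℝ),
      (∀ᶠ M in atTop, IsSecondOrderDFM (μ M) A C (G M) (R M) (x M) (w M) (y M) (v M)) →
      ∀ t : ℕ → ℤ, FilterCollapses A C G R fun M => predictionCov (μ M) (x M) (y M) (t M)) := by
  have hinj : ∀ {m : ℕ} {B : Matrix (Fin m) (Fin N) ℝ}, B.rank = N →
      Function.Injective B.mulVec := fun hB =>
    mulVec_injective_of_rank_eq_card (hB.trans (Fintype.card_fin N).symm)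
  have hCunit : IsUnit C := Matrix.mulVec_injective_iff_isUnit.1 (hinj hC)
  have hcollapse {S : ℕ → Matrix (Fin N) (Fin N) ℝ} :=
    filterCollapses_of_le_of_le_add (A := A) (S := S) hCunit hR (hG.mono fun _ => hinj) hinfo
  refine ⟨fun M hGM => ⟨?_, fun S hS => hS.posDef (hR M) hCunit⟩, fun S hS => ?_,
    fun Ω _ μ _ x w y v h t => ?_⟩
  · exact existsUnique_isSteadyStateCov (hR M) hCunit (mul_glsEstimator_mul (hR M) (hinj hGM))
  · exact hcollapse (hS.mono fun M hM => hM.mul_transpose_le (hR M))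
      ((hS.and hG).mono fun M hM => hM.1.le_add_informationMatrix_inv (hR M) (hinj hM.2))
  · exact hcollapse (h.mono fun M hM => hM.mul_transpose_le_predictionCov (t M))
      ((h.and hG).mono fun M hM =>
        hM.1.predictionCov_le_add_informationMatrix_inv (hR M) (hinj hM.2) (t M))

theorem mainTheorem3 {N : ℕ} (A C : Matrix (Fin N) (Fin N) ℝ)
    (G : ∀ M : ℕ, Matrix (Fin M) (Fin N) ℝ) (R : ∀ M : ℕ, Matrix (Fin M) (Fin M) ℝ) (σ : ℝ)
    (hassum : FactorModelAssumption A G R σ) (hC : C.rank = N) :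
    -- the steady-state covariance exists, is unique and is invertible
    (∀ M, (G M).rank = N →
      (∃! S, IsSteadyStateCov A C (G M) (R M) S) ∧
      ∀ S, IsSteadyStateCov A C (G M) (R M) S → IsUnit S) ∧
    -- the asymptotic claims for the steady-state covariances
    (∀ S : ℕ → Matrix (Fin N) (Fin N) ℝ,
      (∀ᶠ M in atTop, IsSteadyStateCov A C (G M) (R M) (S M)) →
      FilterCollapses A C G R S) ∧
    -- the same claims for the prediction covariances of stationary realizations of the models
    (∀ (Ω : ℕ → Type*) (_ : ∀ M, MeasurableSpace (Ω M)) (μ : ∀ M, Measure (Ω M))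
      (_ : ∀ M, IsProbabilityMeasure (μ M))
      (x w : ∀ M, ℤ → Ω M → Fin N → ℝ) (y v : ∀ M, ℤ → Ω M → Fin M → ℝ),
      (∀ᶠ M in atTop, IsStationaryDFM (μ M) A C (G M) σ (x M) (w M) (y M) (v M)) →
      ∀ t : ℤ, FilterCollapses A C G R fun M => predictionCov (μ M) (x M) (y M) t) := by
  obtain ⟨hsteady, hlimit, hprediction⟩ := mainTheorem3_general A C G R hassum.posDef_noise
    hassum.rank_G hassum.informationMatrix_inv_isBigO hC
  refine ⟨fun M hGM => (hsteady M hGM).imp_right fun h S hS => (h S hS).isUnit, hlimit,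
    fun Ω _ μ hμ x w y v h t => hprediction Ω _ μ hμ x w y v (h.mono fun M hM => ?_) fun _ => t⟩
  rw [hassum.noise]
  exact hM.isSecondOrderDFM
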